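/- **Generalized Hybrid Quantum Speed Limit.** Let $\hbar,m>0$, $q>0$ with $q\neq1$, and $\alpha\in(1,2]$. On $L^2(\mathbb R)$ let the hybrid kinetic operator $\hat K_{q,\alpha}$ be the Fourier multiplier $$\hat K_{q,\alpha}\psi=\mathcal F^{-1}\Big[(2m)^{-\alpha/2}\,\Big|\tfrac{2\hbar}{q-1}\sin\big(\tfrac{k\ln q}{2}\big)\Big|^{\alpha}\,\mathcal F\psi(k)\Big],$$ where $\mathcal F$ is the unitary Fourier transform and $k$ is the wave number conjugate to $x$, with its maximal domain. Let $V:\mathbb R\to\mathbb R$ be measurable and bounded below, let $V=V(\hat x)$ also denote the operator of multiplication by $V(x)$ with domain $\{\psi\in L^2: V\psi\in L^2\}$, and let $\hat H_{q,\alpha}=\hat K_{q,\alpha}+V(\hat x)$ with domain $\mathcal D(\hat K_{q,\alpha})\cap\mathcal D(V(\hat x))$. Then $\hat H_{q,\alpha}$ is self-adjoint, so that the unitary group $U(t)=e^{-it\hat H_{q,\alpha}/\hbar}$ is defined. For every $\psi\in\mathcal D(\hat H_{q,\alpha})$ with $\|\psi\|=1$, the orthogonalization time $\tau_\perp=\inf\{t>0:\langle\psi,U(t)\psi\rangle=0\}\in[0,\infty]$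 satisfies the Mandelstam–Tamm bound $$\tau_\perp\ \ge\ \frac{\pi\hbar}{2\,\Delta H_{q,\alpha}},$$ where the right-hand side is $\infty$ if $\Delta H_{q,\alpha}=0$, and $$(\Delta H_{q,\alpha})^2=(\Delta K_{q,\alpha})^2+(\Delta V)^2+2\,\mathrm{Cov}(\hat K_{q,\alpha},V).$$ Here $(\Delta A)^2=\langle A^2\rangle-\langle A\rangle^2$ with $\langle A\rangle=\langle\psi,A\psi\rangle$ and $\langle A^2\rangle=\|A\psi\|^2$, and $$\mathrm{Cov}(\hat K_{q,\alpha},V)=\tfrac12\langle \hat K_{q,\alpha}V+V\hat K_{q,\alpha}\rangle-\langle\hat K_{q,\alpha}\rangle\langle V\rangle,$$ where the symmetrized expectation is understood in the sense of quadratic forms, $\tfrac12\langle \hat K_{q,\alpha}V+V\hat K_{q,\alpha}\rangle=\tfrac12\big(\langle\hat K_{q,\alpha}\psi,V\psi\rangle+\langle V\psi,\hat K_{q,\alpha}\psi\rangle\big)$; it equals $\tfrac12\langle\psi,(\hat K_{q,\alpha}V+V\hat K_{q,\alpha})\psi\rangle$ whenever $V\psi\in\mathcal D(\hat K_{q,\alpha})$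 and $\hat K_{q,\alpha}\psi\in\mathcal D(V(\hat x))$. -/

import Mathlib

open MeasureTheory
open scoped ENNReal

noncomputable section

namespace HybridQM

/-- The Hilbert space `L²(ℝ)` of complex-valued functions on the line, with Lebesgue measure. -/
abbrev StateSpace : Type := Lp ℂ 2 (volume : Measure ℝ)

/-- The maximal multiplication operator `(f(x̂) ψ)(x) = f(x) ψ(x)` in `L²(ℝ)` by a real function
`f`, with domain `{ψ ∈ L² | f ψ ∈ L²}`. -/
def mulOp (f : ℝ → ℝ) : StateSpace →ₗ.[ℂ] StateSpace where
  domain :=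
    { carrier := {ψ | MemLp (fun x => (f x : ℂ) * ψ x) 2 volume}
      zero_mem' := by
        refine (memLp_congr_ae ?_).2 (MemLp.zero : MemLp (0 : ℝ → ℂ) 2 volume)
        filter_upwards [Lp.coeFn_zero ℂ 2 (volume : Measure ℝ)] with x hx
        rw [hx, Pi.zero_apply, mul_zero]
      add_mem' := by
        intro ψ φ hψ hφ
        refine (memLp_congr_ae ?_).2 (MemLp.add hψ hφ)
        filter_upwards [Lp.coeFn_add ψ φ] with x hx
        rw [hx, Pi.add_apply, Pi.add_apply, mul_add]
      smul_mem' := by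
        intro c ψ hψ
        refine (memLp_congr_ae ?_).2 (MemLp.const_smul hψ c)
        filter_upwards [Lp.coeFn_smul c ψ] with x hx
        simp [hx, mul_left_comm] }
  toFun :=
    { toFun := fun ψ => MemLp.toLp (fun x => (f x : ℂ) * (ψ : StateSpace) x) ψ.2
      map_add' := by
        intro ψ φ
        rw [← MemLp.toLp_add]
        refine MemLp.toLp_congr _ _ ?_
        filter_upwards [Lp.coeFn_add (ψ : StateSpace) (φ : StateSpace)] with x hx
        rw [Submodule.coe_add, hx, Pi.add_apply, Pi.add_apply, mul_add]
      map_smul' := by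
        intro c ψ
        rw [RingHom.id_apply, ← MemLp.toLp_const_smul]
        refine MemLp.toLp_congr _ _ ?_
        filter_upwards [Lp.coeFn_smul c (ψ : StateSpace)] with x hx
        simp [hx, mul_left_comm] }

/-- Mathlib's unitary Fourier transform on `L²(ℝ)`, `(𝓕 ψ)(ξ) = ∫ exp(-2πi ξ x) ψ(x) dx` for
Schwartz functions. -/
abbrev fourierL2 : StateSpace ≃ₗᵢ[ℂ] StateSpace := Lp.fourierTransformₗᵢ ℝ ℂ

/-- The Fourier multiplier with real symbol `g(k)`, where `k` is the wave number conjugate to `x`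
(the plane wave `exp(ikx)` is multiplied by `g(k)`), on its maximal domain
`{ψ ∈ L² | g ψ̃ ∈ L²}`. Since Mathlib's Fourier variable is `ξ = k / (2π)`, the symbol is
`g(2πξ)` in that variable. -/
def fourierMultiplierOp (g : ℝ → ℝ) : StateSpace →ₗ.[ℂ] StateSpace where
  domain := (mulOp fun ξ => g (2 * Real.pi * ξ)).domain.comap
    (fourierL2.toLinearEquiv : StateSpace →ₗ[ℂ] StateSpace)
  toFun :=
    (fourierL2.symm.toLinearEquiv : StateSpace →ₗ[ℂ] StateSpace) ∘ₗ
      (mulOp fun ξ => g (2 * Real.pi * ξ)).toFun ∘ₗ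
      (fourierL2.toLinearEquiv : StateSpace →ₗ[ℂ] StateSpace).restrict
        (fun _ hψ => Submodule.mem_comap.1 hψ)

/-- The symbol of the hybrid kinetic operator,
`E(k) = (2m)^(-α/2) |2ħ/(q-1) · sin(k ln q / 2)|^α`. -/
def kineticSymbol (ħ m q α : ℝ) (k : ℝ) : ℝ :=
  (2 * m) ^ (-α / 2) * |2 * ħ / (q - 1) * Real.sin (k * Real.log q / 2)| ^ α

/-- The hybrid kinetic operator `K_{q,α}`. -/
def kineticOp (ħ m q α : ℝ) : StateSpace →ₗ.[ℂ] StateSpace :=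
  fourierMultiplierOp (kineticSymbol ħ m q α)

/-- The hybrid Hamiltonian `H_{q,α} = K_{q,α} + V(x̂)`, with domain `D(K_{q,α}) ∩ D(V(x̂))`. -/
def hamiltonian (ħ m q α : ℝ) (V : ℝ → ℝ) : StateSpace →ₗ.[ℂ] StateSpace :=
  kineticOp ħ m q α + mulOp V

theorem mem_hamiltonian_domain {ħ m q α : ℝ} {V : ℝ → ℝ} {ψ : StateSpace} :
    ψ ∈ (hamiltonian ħ m q α V).domain ↔
      ψ ∈ (kineticOp ħ m q α).domain ∧ ψ ∈ (mulOp V).domain :=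
  Iff.rfl

/-- The expectation `⟨A⟩ = ⟨ψ, A ψ⟩` of a symmetric operator `A` in a normalized state `ψ ∈ D(A)`
(a real number). -/
def expectation (A : StateSpace →ₗ.[ℂ] StateSpace) (ψ : A.domain) : ℝ :=
  (inner ℂ (ψ : StateSpace) (A ψ)).re

/-- The second moment `⟨A²⟩ = ⟨A ψ, A ψ⟩` of a symmetric operator `A` in a normalized state
`ψ ∈ D(A)`. -/
def secondMoment (A : StateSpace →ₗ.[ℂ] StateSpace) (ψ : A.domain) : ℝ :=
  ‖A ψ‖ ^ 2

/-- The variance `(ΔA)² = ⟨A²⟩ - ⟨A⟩²`. -/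
def variance (A : StateSpace →ₗ.[ℂ] StateSpace) (ψ : A.domain) : ℝ :=
  secondMoment A ψ - expectation A ψ ^ 2

/-- The standard deviation `ΔA = √(⟨A²⟩ - ⟨A⟩²)`. -/
def stdDev (A : StateSpace →ₗ.[ℂ] StateSpace) (ψ : A.domain) : ℝ :=
  Real.sqrt (variance A ψ)

/-- The symmetrized expectation `½⟨AB + BA⟩ = ½(⟨A ψ, B ψ⟩ + ⟨B ψ, A ψ⟩)` of two symmetric
operators in a state `ψ ∈ D(A) ∩ D(B)`, in the sense of quadratic forms. -/
def symmExpectation (A B : StateSpace →ₗ.[ℂ] StateSpace) (ψ : StateSpace)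
    (hA : ψ ∈ A.domain) (hB : ψ ∈ B.domain) : ℂ :=
  (1 / 2 : ℂ) * (inner ℂ (A ⟨ψ, hA⟩) (B ⟨ψ, hB⟩) + inner ℂ (B ⟨ψ, hB⟩) (A ⟨ψ, hA⟩))

/-- The covariance `Cov(A, B) = ½⟨AB + BA⟩ - ⟨A⟩⟨B⟩`. The symmetrized expectation is a real
number. -/
def covariance (A B : StateSpace →ₗ.[ℂ] StateSpace) (ψ : StateSpace)
    (hA : ψ ∈ A.domain) (hB : ψ ∈ B.domain) : ℝ :=
  (symmExpectation A B ψ hA hB).re - expectation A ⟨ψ, hA⟩ * expectation B ⟨ψ, hB⟩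

/-- `U(t) = exp(-itH/ħ)`: `U` is a strongly continuous one-parameter group of unitary operators,
and its generator is exactly `-iH/ħ`, that is, `t ↦ U(t) ψ` is differentiable at `0` if and only if
`ψ ∈ D(H)`, and then its derivative at `0` is `-(i/ħ) H ψ`. -/
structure IsUnitaryEvolution (ħ : ℝ) (H : StateSpace →ₗ.[ℂ] StateSpace)
    (U : ℝ → (StateSpace ≃ₗᵢ[ℂ] StateSpace)) : Prop where
  map_zero : ∀ ψ, U 0 ψ = ψ
  map_add : ∀ s t ψ, U (s + t) ψ = U s (U t ψ)
  continuous : ∀ ψ, Continuous fun t => U t ψ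
  generator : ∀ ψ φ : StateSpace,
    HasDerivAt (fun t => U t ψ) (-(Complex.I / (ħ : ℂ)) • φ) 0 ↔
      ∃ h : ψ ∈ H.domain, H ⟨ψ, h⟩ = φ

/-- The orthogonalization time: the least time `t > 0` at which `U(t) ψ` is orthogonal to `ψ`
(`∞` if there is none). -/
def orthogonalizationTime (U : ℝ → (StateSpace ≃ₗᵢ[ℂ] StateSpace)) (ψ : StateSpace) : ℝ≥0∞ :=
  ⨅ (t : ℝ) (_ : 0 < t ∧ inner ℂ ψ (U t ψ) = 0), ENNReal.ofReal t

end HybridQM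

end

namespace HybridQM

/-! ### Maximal multiplication operators -/

/-! Since `|sin| ≤ 1`, the kinetic symbol is bounded, so `K` is symmetric and defined everywhere.
Self-adjointness of `K + V` thus reduces to maximality of multiplication by `V`: if `y` lies in the
adjoint domain, `K` can be moved onto `y`, and what remains says that `V y` is in `L²`
(`isSelfAdjoint_add_mulOp`, resting on `coeFn_eq_mul_of_forall_inner`).

For the time bound, multiply `U(t)ψ` by the phase `exp(it⟨H⟩/ħ)`. The resulting curve on the unit
sphere has velocity orthogonal to its position and of constant norm `ΔH/ħ`. The arcsine of the real
overlap with the initial point then changes at rate at most `ΔH/ħ`, yet must fall from `π/2` to `0`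
(`pi_div_two_le_mul_of_curve`). The variance formula is the expansion of `‖Kψ + Vψ‖²`. -/

theorem coeFn_mulOp (f : ℝ → ℝ) (ψ : (mulOp f).domain) :
    mulOp f ψ =ᵐ[volume] fun x => (f x : ℂ) * (ψ : StateSpace) x :=
  MemLp.coeFn_toLp ψ.2

theorem mulOp_isFormalAdjoint (f : ℝ → ℝ) : (mulOp f).IsFormalAdjoint (mulOp f) := by
  intro x y
  rw [L2.inner_def, L2.inner_def]
  refine integral_congr_ae ?_
  filter_upwards [coeFn_mulOp f x, coeFn_mulOp f y] with t hx hy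
  rw [hx, hy]
  simp only [RCLike.inner_apply, map_mul, Complex.conj_ofReal]
  ring

theorem memLp_mul_of_bounded {g : ℝ → ℝ} (hg : AEMeasurable g volume) {C : ℝ}
    (hC : ∀ x, |g x| ≤ C) (ψ : StateSpace) :
    MemLp (fun x => (g x : ℂ) * ψ x) 2 volume := by
  refine (Lp.memLp ψ).of_le_mul (c := C) ?_ (Filter.Eventually.of_forall fun x => ?_)
  · exact (Complex.measurable_ofReal.comp_aemeasurable hg).aestronglyMeasurable.mul
      (Lp.memLp ψ).1
  · rw [norm_mul, Complex.norm_real, Real.norm_eq_abs]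
    exact mul_le_mul_of_nonneg_right (hC x) (norm_nonneg _)

theorem mulOp_domain_eq_top {g : ℝ → ℝ} (hg : AEMeasurable g volume) {C : ℝ}
    (hC : ∀ x, |g x| ≤ C) : (mulOp g).domain = ⊤ :=
  eq_top_iff.2 fun ψ _ => memLp_mul_of_bounded hg hC ψ

/-- The function `1 / (1 + |f|)`, multiplication by which maps `L²` into the domain of `mulOp f`. -/
noncomputable def cutoff (f : ℝ → ℝ) (x : ℝ) : ℝ := (1 + |f x|)⁻¹

theorem cutoff_pos (f : ℝ → ℝ) (x : ℝ) : 0 < cutoff f x := by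
  unfold cutoff
  positivity

theorem abs_cutoff_le (f : ℝ → ℝ) (x : ℝ) : |cutoff f x| ≤ 1 := by
  rw [abs_of_pos (cutoff_pos f x)]
  exact inv_le_one_of_one_le₀ (by linarith [abs_nonneg (f x)])

theorem abs_mul_cutoff_le (f : ℝ → ℝ) (x : ℝ) : |f x * cutoff f x| ≤ 1 := by
  rw [abs_mul, abs_of_pos (cutoff_pos f x), cutoff, ← div_eq_mul_inv,
    div_le_one (by positivity)]
  linarith

theorem aemeasurable_cutoff {f : ℝ → ℝ} (hf : AEMeasurable f volume) :
    AEMeasurable (cutoff f) volume := by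
  have h : AEMeasurable (fun x => |f x|) volume := measurable_norm.comp_aemeasurable hf
  exact (h.const_add 1).inv

/-- Multiplication by `cutoff f`. -/
noncomputable def cutoffMul {f : ℝ → ℝ} (hf : AEMeasurable f volume) (w : StateSpace) : StateSpace :=
  (memLp_mul_of_bounded (aemeasurable_cutoff hf) (abs_cutoff_le f) w).toLp _

theorem coeFn_cutoffMul {f : ℝ → ℝ} (hf : AEMeasurable f volume) (w : StateSpace) :
    cutoffMul hf w =ᵐ[volume] fun x => (cutoff f x : ℂ) * w x :=
  MemLp.coeFn_toLp _

theorem cutoffMul_mem {f : ℝ → ℝ} (hf : AEMeasurable f volume) (w : StateSpace) :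
    cutoffMul hf w ∈ (mulOp f).domain := by
  refine (memLp_congr_ae ?_).2
    (memLp_mul_of_bounded (hf.mul (aemeasurable_cutoff hf)) (abs_mul_cutoff_le f) w)
  filter_upwards [coeFn_cutoffMul hf w] with x hx
  rw [hx]
  simp only [Pi.mul_apply, Complex.ofReal_mul]
  ring

/-- If `⟨z, x⟩ = ⟨y, f x⟩` for all `x` in the domain of `mulOp f`, then `z = f y`. -/
theorem coeFn_eq_mul_of_forall_inner {f : ℝ → ℝ} (hf : AEMeasurable f volume) {y z : StateSpace}
    (h : ∀ x : (mulOp f).domain, inner ℂ z (x : StateSpace) = inner ℂ y (mulOp f x)) :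
    z =ᵐ[volume] fun x => (f x : ℂ) * y x := by
  set v : StateSpace :=
    (memLp_mul_of_bounded (hf.mul (aemeasurable_cutoff hf)) (abs_mul_cutoff_le f) y).toLp _
    with hv
  have hvc : v =ᵐ[volume] fun x => ((f x * cutoff f x : ℝ) : ℂ) * y x := MemLp.coeFn_toLp _
  -- The hypothesis is tested on the vectors `cutoff f · w` only; the bounded real factors then move
  -- across the inner product, which gives `cutoff f · z = f · cutoff f · y`. The positive factor
  -- cancels pointwise.
  have key : ∀ w : StateSpace, inner ℂ (cutoffMul hf z) w = inner ℂ v w := by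
    intro w
    have h1 := h ⟨cutoffMul hf w, cutoffMul_mem hf w⟩
    have e1 : inner ℂ (cutoffMul hf z) w = inner ℂ z (cutoffMul hf w) := by
      rw [L2.inner_def, L2.inner_def]
      refine integral_congr_ae ?_
      filter_upwards [coeFn_cutoffMul hf z, coeFn_cutoffMul hf w] with t hz hw
      rw [hz, hw]
      simp only [RCLike.inner_apply, map_mul, Complex.conj_ofReal]
      ring
    have e2 : inner ℂ v w = inner ℂ y (mulOp f ⟨cutoffMul hf w, cutoffMul_mem hf w⟩) := by
      rw [L2.inner_def, L2.inner_def]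
      refine integral_congr_ae ?_
      filter_upwards [hvc, coeFn_cutoffMul hf w,
        coeFn_mulOp f ⟨cutoffMul hf w, cutoffMul_mem hf w⟩] with t hv hw hm
      rw [hv, hm, hw]
      simp only [RCLike.inner_apply, map_mul, Complex.conj_ofReal, Complex.ofReal_mul]
      ring
    rw [e1, e2, h1]
  have hzv : cutoffMul hf z = v := ext_inner_right ℂ key
  have hae : cutoffMul hf z =ᵐ[volume] v := by rw [hzv]
  filter_upwards [hae, coeFn_cutoffMul hf z, hvc] with t h1 h2 h3
  rw [h2, h3] at h1
  have hc : (cutoff f t : ℂ) ≠ 0 := Complex.ofReal_ne_zero.2 (cutoff_pos f t).ne'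
  refine mul_left_cancel₀ hc (h1.trans ?_)
  push_cast
  ring

theorem mem_mulOp_domain_of_forall_inner {f : ℝ → ℝ} (hf : AEMeasurable f volume)
    {y z : StateSpace}
    (h : ∀ x : (mulOp f).domain, inner ℂ z (x : StateSpace) = inner ℂ y (mulOp f x)) :
    y ∈ (mulOp f).domain :=
  (memLp_congr_ae (coeFn_eq_mul_of_forall_inner hf h)).1 (Lp.memLp z)

/-- A vector `z` orthogonal to the domain satisfies `⟨z, x⟩ = ⟨0, f x⟩` there, hence `z = f · 0 =
0`. -/
theorem dense_mulOp_domain {f : ℝ → ℝ} (hf : AEMeasurable f volume) :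
    Dense ((mulOp f).domain : Set StateSpace) := by
  rw [Submodule.dense_iff_topologicalClosure_eq_top, Submodule.topologicalClosure_eq_top_iff,
    Submodule.eq_bot_iff]
  intro z hz
  have h : ∀ x : (mulOp f).domain,
      inner ℂ z (x : StateSpace) = inner ℂ (0 : StateSpace) (mulOp f x) := fun x => by
    rw [inner_zero_left]
    exact (Submodule.mem_orthogonal' _ _).1 hz x x.2
  refine Lp.ext ?_
  filter_upwards [coeFn_eq_mul_of_forall_inner hf h, Lp.coeFn_zero ℂ 2 (volume : Measure ℝ)]
    with t h1 h2
  rw [h1, h2]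
  simp

/-! ### Fourier multipliers -/

theorem fourierMultiplierOp_isFormalAdjoint (g : ℝ → ℝ) :
    (fourierMultiplierOp g).IsFormalAdjoint (fourierMultiplierOp g) := by
  intro x y
  have e : ∀ z : (fourierMultiplierOp g).domain, fourierMultiplierOp g z =
      fourierL2.symm (mulOp (fun ξ => g (2 * Real.pi * ξ)) ⟨fourierL2 (z : StateSpace), z.2⟩) :=
    fun _ => rfl
  have h := mulOp_isFormalAdjoint (fun ξ => g (2 * Real.pi * ξ))
    ⟨fourierL2 (x : StateSpace), x.2⟩ ⟨fourierL2 (y : StateSpace), y.2⟩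
  rw [e x, e y, ← fourierL2.inner_map_map, ← fourierL2.inner_map_map (x : StateSpace),
    LinearIsometryEquiv.apply_symm_apply, LinearIsometryEquiv.apply_symm_apply]
  exact h

theorem measurable_kineticSymbol (ħ m q α : ℝ) : Measurable (kineticSymbol ħ m q α) := by
  unfold kineticSymbol
  fun_prop

theorem abs_kineticSymbol_le (ħ q : ℝ) {m α : ℝ} (hm : 0 ≤ m) (hα : 0 ≤ α) (k : ℝ) :
    |kineticSymbol ħ m q α k| ≤ (2 * m) ^ (-α / 2) * |2 * ħ / (q - 1)| ^ α := by
  unfold kineticSymbol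
  rw [abs_of_nonneg (by positivity)]
  refine mul_le_mul_of_nonneg_left (Real.rpow_le_rpow (abs_nonneg _) ?_ hα) (by positivity)
  refine (abs_mul _ _).trans_le ?_
  exact mul_le_of_le_one_right (abs_nonneg _) (Real.abs_sin_le_one _)

theorem kineticOp_domain (ħ q : ℝ) {m α : ℝ} (hm : 0 ≤ m) (hα : 0 ≤ α) :
    (kineticOp ħ m q α).domain = ⊤ := by
  have h : (mulOp fun ξ => kineticSymbol ħ m q α (2 * Real.pi * ξ)).domain = ⊤ :=
    mulOp_domain_eq_top
      ((measurable_kineticSymbol ħ m q α).comp (measurable_const_mul _)).aemeasurable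
      fun x => abs_kineticSymbol_le ħ q hm hα _
  change (mulOp fun ξ => kineticSymbol ħ m q α (2 * Real.pi * ξ)).domain.comap _ = ⊤
  rw [h, Submodule.comap_top]

/-! ### Self-adjointness -/

theorem isFormalAdjoint_add {A B : StateSpace →ₗ.[ℂ] StateSpace} (hA : A.IsFormalAdjoint A)
    (hB : B.IsFormalAdjoint B) : (A + B).IsFormalAdjoint (A + B) := by
  intro x y
  rw [LinearPMap.add_apply, LinearPMap.add_apply, inner_add_left, inner_add_right]
  exact congrArg₂ (· + ·) (hA ⟨x, x.2.1⟩ ⟨y, y.2.1⟩) (hB ⟨x, x.2.2⟩ ⟨y, y.2.2⟩)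

/-- A symmetric operator with domain the whole space plus a multiplication operator is
self-adjoint. -/
theorem isSelfAdjoint_add_mulOp {A : StateSpace →ₗ.[ℂ] StateSpace} (hA : A.IsFormalAdjoint A)
    (hdom : A.domain = ⊤) {V : ℝ → ℝ} (hV : AEMeasurable V volume) :
    IsSelfAdjoint (A + mulOp V) := by
  have hmem : ∀ x, x ∈ A.domain := fun x => hdom ▸ Submodule.mem_top
  have hdense : Dense ((A + mulOp V).domain : Set StateSpace) := by
    rw [LinearPMap.add_domain, hdom, top_inf_eq]
    exact dense_mulOp_domain hV
  have hle := (isFormalAdjoint_add hA (mulOp_isFormalAdjoint V)).le_adjoint hdense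
  rw [LinearPMap.isSelfAdjoint_def]
  refine (LinearPMap.eq_of_le_of_domain_eq hle (le_antisymm hle.1 fun y hy => ?_)).symm
  -- With `z = (A + V)* y - A y`, symmetry of `A` leaves `⟨z, x⟩ = ⟨y, V x⟩` for all `x` in the
  -- domain of `V`.
  refine ⟨hmem y, mem_mulOp_domain_of_forall_inner hV
    (z := (A + mulOp V).adjoint ⟨y, hy⟩ - A ⟨y, hmem y⟩) fun x => ?_⟩
  have h1 := LinearPMap.adjoint_isFormalAdjoint hdense ⟨y, hy⟩ ⟨x, hmem x, x.2⟩
  rw [LinearPMap.add_apply, inner_add_right] at h1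
  rw [inner_sub_left, hA ⟨y, hmem y⟩ ⟨x, hmem x⟩]
  exact sub_eq_of_eq_add' h1

/-! ### Moments of symmetric operators -/

theorem ofReal_expectation {A : StateSpace →ₗ.[ℂ] StateSpace} (hA : A.IsFormalAdjoint A)
    (ψ : A.domain) : (expectation A ψ : ℂ) = inner ℂ (ψ : StateSpace) (A ψ) := by
  refine Complex.conj_eq_iff_re.1 ?_
  rw [inner_conj_symm]
  exact hA ψ ψ

theorem inner_sub_expectation {A : StateSpace →ₗ.[ℂ] StateSpace} (hA : A.IsFormalAdjoint A)
    (ψ : A.domain) (hψ : ‖(ψ : StateSpace)‖ = 1) :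
    inner ℂ (ψ : StateSpace) (A ψ - (expectation A ψ : ℂ) • (ψ : StateSpace)) = 0 := by
  rw [inner_sub_right, inner_smul_right, inner_self_eq_norm_sq_to_K, hψ, ofReal_expectation hA]
  simp

/-- Pythagoras for the orthogonal splitting `Aψ = (Aψ - ⟨A⟩ψ) + ⟨A⟩ψ`. -/
theorem norm_sub_expectation {A : StateSpace →ₗ.[ℂ] StateSpace} (hA : A.IsFormalAdjoint A)
    (ψ : A.domain) (hψ : ‖(ψ : StateSpace)‖ = 1) :
    ‖A ψ - (expectation A ψ : ℂ) • (ψ : StateSpace)‖ = stdDev A ψ := by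
  have h := norm_add_sq (𝕜 := ℂ) (A ψ - (expectation A ψ : ℂ) • (ψ : StateSpace))
    ((expectation A ψ : ℂ) • (ψ : StateSpace))
  rw [sub_add_cancel, inner_smul_right, ← inner_conj_symm, inner_sub_expectation hA ψ hψ,
    norm_smul, hψ, Complex.norm_real, mul_one, Real.norm_eq_abs, sq_abs] at h
  simp only [map_zero, mul_zero, add_zero] at h
  rw [stdDev, variance, secondMoment, h, add_sub_cancel_right, Real.sqrt_sq (norm_nonneg _)]

theorem variance_add (A B : StateSpace →ₗ.[ℂ] StateSpace) (ψ : StateSpace)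
    (hA : ψ ∈ A.domain) (hB : ψ ∈ B.domain) :
    variance (A + B) ⟨ψ, hA, hB⟩ =
      variance A ⟨ψ, hA⟩ + variance B ⟨ψ, hB⟩ + 2 * covariance A B ψ hA hB := by
  have hadd : (A + B) ⟨ψ, hA, hB⟩ = A ⟨ψ, hA⟩ + B ⟨ψ, hB⟩ := rfl
  have hs : (symmExpectation A B ψ hA hB).re = (inner ℂ (A ⟨ψ, hA⟩) (B ⟨ψ, hB⟩)).re := by
    rw [symmExpectation, ← inner_conj_symm (B ⟨ψ, hB⟩), Complex.add_conj]
    simp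
  have hn := norm_add_sq (𝕜 := ℂ) (A ⟨ψ, hA⟩) (B ⟨ψ, hB⟩)
  simp only [RCLike.re_to_complex] at hn
  rw [covariance, hs]
  simp only [variance, secondMoment, expectation, hadd, inner_add_right, Complex.add_re, hn]
  ring

theorem symmExpectation_eq {A B : StateSpace →ₗ.[ℂ] StateSpace} (hA : A.IsFormalAdjoint A)
    (hB : B.IsFormalAdjoint B) (ψ : StateSpace) (hψA : ψ ∈ A.domain) (hψB : ψ ∈ B.domain)
    (hAB : B ⟨ψ, hψB⟩ ∈ A.domain) (hBA : A ⟨ψ, hψA⟩ ∈ B.domain) :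
    symmExpectation A B ψ hψA hψB =
      (1 / 2 : ℂ) * inner ℂ ψ (A ⟨B ⟨ψ, hψB⟩, hAB⟩ + B ⟨A ⟨ψ, hψA⟩, hBA⟩) := by
  have h1 := hA ⟨ψ, hψA⟩ ⟨B ⟨ψ, hψB⟩, hAB⟩
  have h2 := hB ⟨ψ, hψB⟩ ⟨A ⟨ψ, hψA⟩, hBA⟩
  dsimp only at h1 h2
  rw [symmExpectation, inner_add_right, h1, h2]

/-! ### The Mandelstam-Tamm bound -/

section Curve

variable {E : Type*} [NormedAddCommGroup E] [InnerProductSpace ℂ E]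

/-- As `d ⊥ γ`, replacing `x` by `x - cγ` with `c = Re⟨x, γ⟩` leaves `⟨x, d⟩` unchanged, and `‖x -
cγ‖² = 1 - c²`; Cauchy–Schwarz finishes. -/
theorem abs_re_inner_le_of_orthogonal {x γ d : E} (hx : ‖x‖ = 1) (hγ : ‖γ‖ = 1)
    (hd : inner ℂ γ d = 0) :
    |(inner ℂ x d).re| ≤ ‖d‖ * Real.sqrt (1 - (inner ℂ x γ).re ^ 2) := by
  set c : ℝ := (inner ℂ x γ).re with hc
  have h1 : inner ℂ x d = inner ℂ (x - (c : ℂ) • γ) d := by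
    rw [inner_sub_left, inner_smul_left, hd, mul_zero, sub_zero]
  have h2 : ‖x - (c : ℂ) • γ‖ ^ 2 = 1 - c ^ 2 := by
    rw [norm_sub_sq (𝕜 := ℂ), inner_smul_right, norm_smul, hx, hγ, Complex.norm_real,
      Real.norm_eq_abs, mul_one, sq_abs, RCLike.re_to_complex, Complex.re_ofReal_mul, ← hc]
    ring
  rw [← h2, Real.sqrt_sq (norm_nonneg _), h1, mul_comm]
  exact (Complex.abs_re_le_norm _).trans (norm_inner_le_norm _ _)

/-- A curve on the unit sphere whose velocity is complex-orthogonal to the position and has norm at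
most `ω` needs at least the time `π / (2 ω)` to become orthogonal to its initial point. -/
theorem pi_div_two_le_mul_of_curve [NormedSpace ℝ E] {γ d : ℝ → E} {ω τ : ℝ}
    (hγ : ∀ t, HasDerivAt γ (d t) t) (hn : ∀ t, ‖γ t‖ = 1) (ho : ∀ t, inner ℂ (γ t) (d t) = 0)
    (hd : ∀ t, ‖d t‖ ≤ ω) (hτ : 0 ≤ τ) (hz : inner ℂ (γ 0) (γ τ) = 0) :
    Real.pi / 2 ≤ ω * τ := by
  set u : ℝ → ℝ := fun t => (inner ℂ (γ 0) (γ t)).re with hu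
  have hu' : ∀ t, HasDerivAt u (inner ℂ (γ 0) (d t)).re t := fun t => by
    have h := ((hasDerivAt_const t (γ 0)).inner ℂ (hγ t))
    rw [inner_zero_left, add_zero] at h
    exact Complex.reCLM.hasFDerivAt.comp_hasDerivAt t h
  have hub : ∀ t, |u t| ≤ 1 := fun t => by
    refine (Complex.abs_re_le_norm _).trans ((norm_inner_le_norm _ _).trans ?_)
    rw [hn, hn, one_mul]
  have hω : 0 ≤ ω := (norm_nonneg _).trans (hd 0)
  have hu0 : u 0 = 1 := by
    simp only [hu, inner_self_eq_norm_sq_to_K, hn]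
    simp
  have huτ : u τ = 0 := by simp only [hu, hz, Complex.zero_re]
  -- `arcsin` is not differentiable at `1 = u 0`. Scaling by `c < 1` keeps the argument inside `(-1,
  -- 1)`; the limit `c → 1` is taken at the end.
  have key : ∀ c ∈ Set.Ioo (0 : ℝ) 1, Real.arcsin c ≤ ω * τ := by
    intro c hc
    have hlt : ∀ t, |c * u t| < 1 := fun t => by
      rw [abs_mul, abs_of_pos hc.1]
      nlinarith [hub t, hc.1, hc.2]
    have hder : ∀ t, HasDerivAt (fun s => Real.arcsin (c * u s))
        (1 / Real.sqrt (1 - (c * u t) ^ 2) * (c * (inner ℂ (γ 0) (d t)).re)) t := fun t =>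
      HasDerivAt.comp (h₂ := Real.arcsin) (h := fun s => c * u s) t
        (Real.hasDerivAt_arcsin (abs_lt.1 (hlt t)).1.ne' (abs_lt.1 (hlt t)).2.ne)
        ((hu' t).const_mul c)
    have hbound : ∀ t,
        ‖1 / Real.sqrt (1 - (c * u t) ^ 2) * (c * (inner ℂ (γ 0) (d t)).re)‖ ≤ ω := by
      intro t
      have hpos : 0 < 1 - (c * u t) ^ 2 := by
        have := (sq_lt_one_iff_abs_lt_one (c * u t)).2 (hlt t)
        linarith
      have hs : 0 < Real.sqrt (1 - (c * u t) ^ 2) := Real.sqrt_pos.2 hpos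
      have hle : Real.sqrt (1 - u t ^ 2) ≤ Real.sqrt (1 - (c * u t) ^ 2) := by
        refine Real.sqrt_le_sqrt ?_
        have : c ^ 2 ≤ 1 := by nlinarith [hc.1, hc.2]
        nlinarith [sq_nonneg (u t)]
      have h1 := abs_re_inner_le_of_orthogonal (hn 0) (hn t) (ho t)
      rw [Real.norm_eq_abs, abs_mul, abs_of_pos (one_div_pos.2 hs), one_div_mul_eq_div,
        div_le_iff₀ hs, abs_mul, abs_of_pos hc.1]
      calc c * |(inner ℂ (γ 0) (d t)).re| ≤ 1 * |(inner ℂ (γ 0) (d t)).re| :=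
            mul_le_mul_of_nonneg_right hc.2.le (abs_nonneg _)
        _ ≤ ‖d t‖ * Real.sqrt (1 - u t ^ 2) := by rw [one_mul]; exact h1
        _ ≤ ω * Real.sqrt (1 - (c * u t) ^ 2) :=
            mul_le_mul (hd t) hle (Real.sqrt_nonneg _) hω
    -- Mean value inequality: `arcsin (c * u)` runs from `arcsin c` to `0` at speed at most `ω`.
    have hmv := norm_image_sub_le_of_norm_deriv_le_segment' (a := 0) (b := τ)
      (fun t _ => (hder t).hasDerivWithinAt) (fun t _ => hbound t) τ ⟨hτ, le_rfl⟩
    rw [huτ, hu0, mul_zero, mul_one, Real.arcsin_zero, zero_sub, norm_neg, sub_zero] at hmv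
    exact (le_abs_self _).trans hmv
  rw [← Real.arcsin_one]
  have hlim : Filter.Tendsto Real.arcsin (nhdsWithin 1 (Set.Iio 1)) (nhds (Real.arcsin 1)) :=
    Real.continuous_arcsin.continuousWithinAt
  exact le_of_tendsto hlim (Filter.mem_of_superset (Ioo_mem_nhdsLT zero_lt_one) key)

end Curve

/-- The group law `U(s) = U(t) U(s - t)` carries the derivative at `0` to time `t`. -/
theorem IsUnitaryEvolution.hasDerivAt {ħ : ℝ} {H : StateSpace →ₗ.[ℂ] StateSpace}
    {U : ℝ → (StateSpace ≃ₗᵢ[ℂ] StateSpace)} (hU : IsUnitaryEvolution ħ H U) (ψ : H.domain)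
    (t : ℝ) : HasDerivAt (fun s => U s (ψ : StateSpace)) (-(Complex.I / (ħ : ℂ)) • U t (H ψ)) t := by
  have h0 : HasDerivAt (fun s => U s (ψ : StateSpace)) (-(Complex.I / (ħ : ℂ)) • H ψ) (t - t) := by
    rw [sub_self]
    exact (hU.generator ψ (H ψ)).2 ⟨ψ.2, rfl⟩
  have h1 := h0.comp_sub_const t t
  have h2 := (((U t).toContinuousLinearEquiv : StateSpace →L[ℂ] StateSpace).restrictScalars
    ℝ).hasFDerivAt.comp_hasDerivAt t h1
  rw [← map_smul]
  refine h2.congr_of_eventuallyEq (Filter.Eventually.of_forall fun s => ?_)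
  change U s ψ = U t (U (s - t) ψ)
  rw [← hU.map_add, add_sub_cancel]

/-- The Mandelstam-Tamm inequality at a time of orthogonality. -/
theorem IsUnitaryEvolution.pi_mul_le {ħ : ℝ} (hħ : 0 < ħ) {H : StateSpace →ₗ.[ℂ] StateSpace}
    (hH : H.IsFormalAdjoint H) {U : ℝ → (StateSpace ≃ₗᵢ[ℂ] StateSpace)}
    (hU : IsUnitaryEvolution ħ H U) (ψ : H.domain) (hψ : ‖(ψ : StateSpace)‖ = 1) {τ : ℝ}
    (hτ : 0 < τ) (hz : inner ℂ (ψ : StateSpace) (U τ ψ) = 0) :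
    Real.pi * ħ ≤ τ * (2 * stdDev H ψ) := by
  set e : ℝ := expectation H ψ with he
  set φ : StateSpace := H ψ - (e : ℂ) • (ψ : StateSpace) with hφ
  -- This phase cancels the component of the velocity along the state, leaving `-(i/ħ) θ U(t)φ` with
  -- `φ ⊥ ψ` and `‖φ‖ = ΔH`.
  set θ : ℝ → ℂ := fun t => Complex.exp (((t * (e / ħ) : ℝ) : ℂ) * Complex.I) with hθ
  have hθn : ∀ t, ‖θ t‖ = 1 := fun t => Complex.norm_exp_ofReal_mul_I _
  have hθ0 : θ 0 = 1 := by simp [hθ]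
  have hθd : ∀ t, HasDerivAt θ (θ t * (((e / ħ : ℝ) : ℂ) * Complex.I)) t := fun t => by
    have h : HasDerivAt (fun s : ℝ => ((s * (e / ħ) : ℝ) : ℂ)) ((e / ħ : ℝ) : ℂ) t := by
      simpa using ((hasDerivAt_id t).mul_const (e / ħ)).ofReal_comp
    exact (h.mul_const Complex.I).cexp
  have hγ : ∀ t, HasDerivAt (fun s => θ s • U s (ψ : StateSpace))
      ((-(Complex.I / (ħ : ℂ)) * θ t) • U t φ) t := fun t => by
    refine ((hθd t).smul (hU.hasDerivAt ψ t)).congr_deriv ?_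
    rw [hφ, map_sub, map_smul, smul_sub, smul_smul, smul_smul, sub_eq_add_neg, ← neg_smul]
    congr 2
    · ring
    · push_cast
      ring
  have horth : inner ℂ (ψ : StateSpace) φ = 0 := inner_sub_expectation hH ψ hψ
  have hmain := pi_div_two_le_mul_of_curve (ω := stdDev H ψ / ħ) (τ := τ) hγ
    (fun t => by rw [norm_smul, hθn, one_mul, LinearIsometryEquiv.norm_map, hψ])
    (fun t => by
      rw [inner_smul_left, inner_smul_right, LinearIsometryEquiv.inner_map_map, horth, mul_zero,
        mul_zero])
    (fun t => by
      rw [norm_smul, norm_mul, hθn, mul_one, LinearIsometryEquiv.norm_map, hφ, he,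
        norm_sub_expectation hH ψ hψ, norm_neg, norm_div, Complex.norm_I, Complex.norm_real,
        Real.norm_of_nonneg hħ.le, one_div_mul_eq_div])
    hτ.le (by
      rw [hθ0, one_smul, hU.map_zero, inner_smul_right, hz, mul_zero])
  rw [div_mul_eq_mul_div, le_div_iff₀ hħ] at hmain
  linarith

theorem IsUnitaryEvolution.le_orthogonalizationTime {ħ : ℝ} (hħ : 0 < ħ)
    {H : StateSpace →ₗ.[ℂ] StateSpace} (hH : H.IsFormalAdjoint H)
    {U : ℝ → (StateSpace ≃ₗᵢ[ℂ] StateSpace)} (hU : IsUnitaryEvolution ħ H U) (ψ : H.domain)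
    (hψ : ‖(ψ : StateSpace)‖ = 1) :
    ENNReal.ofReal (Real.pi * ħ) / ENNReal.ofReal (2 * stdDev H ψ) ≤
      orthogonalizationTime U ψ := by
  -- The product form also covers `ΔH = 0`: there `πħ ≤ 0` would follow, so no orthogonality time
  -- exists and the infimum is `∞`.
  refine le_iInf₂ fun τ hτ => ENNReal.div_le_of_le_mul ?_
  rw [← ENNReal.ofReal_mul hτ.1.le]
  exact ENNReal.ofReal_le_ofReal (hU.pi_mul_le hħ hH ψ hψ hτ.1 hτ.2)

end HybridQM

theorem theorem3 (ħ m q α : ℝ) (hħ : 0 < ħ) (hm : 0 < m) (hq : 0 < q) (hq1 : q ≠ 1)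
    (hα : 1 < α) (hα2 : α ≤ 2)
    (V : ℝ → ℝ) (hVmeas : AEMeasurable V volume) (hVbdd : BddBelow (Set.range V)) :
    IsSelfAdjoint (HybridQM.hamiltonian ħ m q α V) ∧
    ∀ (ψ : HybridQM.StateSpace) (hK : ψ ∈ (HybridQM.kineticOp ħ m q α).domain)
      (hV : ψ ∈ (HybridQM.mulOp V).domain), ‖ψ‖ = 1 →
      -- the Mandelstam-Tamm bound, in `[0, ∞]`, with the convention `πħ/0 = ∞`
      (∀ U : ℝ → (HybridQM.StateSpace ≃ₗᵢ[ℂ] HybridQM.StateSpace),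
        HybridQM.IsUnitaryEvolution ħ (HybridQM.hamiltonian ħ m q α V) U →
          ENNReal.ofReal (Real.pi * ħ) / ENNReal.ofReal
              (2 * HybridQM.stdDev (HybridQM.hamiltonian ħ m q α V)
                ⟨ψ, HybridQM.mem_hamiltonian_domain.2 ⟨hK, hV⟩⟩)
            ≤ HybridQM.orthogonalizationTime U ψ) ∧
      -- the decomposition of the energy variance
      HybridQM.variance (HybridQM.hamiltonian ħ m q α V)
          ⟨ψ, HybridQM.mem_hamiltonian_domain.2 ⟨hK, hV⟩⟩ =
        HybridQM.variance (HybridQM.kineticOp ħ m q α) ⟨ψ, hK⟩ +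
        HybridQM.variance (HybridQM.mulOp V) ⟨ψ, hV⟩ +
        2 * HybridQM.covariance (HybridQM.kineticOp ħ m q α) (HybridQM.mulOp V) ψ hK hV ∧
      -- the symmetrized expectation is `½⟨ψ, (KV + VK)ψ⟩` whenever `KVψ` and `VKψ` are defined
      (∀ (hKV : HybridQM.mulOp V ⟨ψ, hV⟩ ∈ (HybridQM.kineticOp ħ m q α).domain)
        (hVK : HybridQM.kineticOp ħ m q α ⟨ψ, hK⟩ ∈ (HybridQM.mulOp V).domain),
        HybridQM.symmExpectation (HybridQM.kineticOp ħ m q α) (HybridQM.mulOp V) ψ hK hV =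
          (1 / 2 : ℂ) * inner ℂ ψ
            (HybridQM.kineticOp ħ m q α ⟨HybridQM.mulOp V ⟨ψ, hV⟩, hKV⟩ +
              HybridQM.mulOp V ⟨HybridQM.kineticOp ħ m q α ⟨ψ, hK⟩, hVK⟩)) := by
  have hKsym := HybridQM.fourierMultiplierOp_isFormalAdjoint (HybridQM.kineticSymbol ħ m q α)
  have hVsym := HybridQM.mulOp_isFormalAdjoint V
  refine ⟨HybridQM.isSelfAdjoint_add_mulOp hKsym
    (HybridQM.kineticOp_domain ħ q hm.le (zero_le_one.trans hα.le)) hVmeas, ?_⟩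
  intro ψ hK hV hψ
  exact ⟨fun U hU => hU.le_orthogonalizationTime hħ (HybridQM.isFormalAdjoint_add hKsym hVsym)
      ⟨ψ, HybridQM.mem_hamiltonian_domain.2 ⟨hK, hV⟩⟩ hψ,
    HybridQM.variance_add _ _ ψ hK hV,
    fun hKV hVK => HybridQM.symmExpectation_eq hKsym hVsym ψ hK hV hKV hVK⟩
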